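/- Let $M$ be a smooth $n$-dimensional manifold (without boundary) with a smooth pseudo-Riemannian metric $g$ of arbitrary signature $\eta=\mathrm{diag}(\pm1,\dots,\pm1)$ and with a spin structure, given by local $g$-orthonormal frames $e^i_1,\dots,e^i_n$ on an open cover $(U_i)$ and transition functions $s_{ij}$ with values in the spin group of $\eta$ (here: even products $s$ of nonnull vectors of spinor norm $1$, a double cover of the identity component $SO_0(\eta)$; so for indefinite $\eta$ the manifold is oriented in space and time) covering those of the frames. Let $\gamma_a$ be the gamma matrices of a representation $\rho$ of the Clifford algebra of $\eta$ on $\mathbb{C}^N$, with $\gamma_a\gamma_b+\gamma_b\gamma_a=2\eta_{ab}$ (for Dirac spinors, the irreducible one). A spinor field $\psi$ is a smooth section of the associated spinor bundle, and in each local spin frame the Dirac operator is $$D\psi=\sum_a\gamma^a\Big(e_a(\psi)+\tfrac14\sum_{b,c}g(e_b,\nabla_{e_a}e_c)\,\gamma^b\gamma^c\psi\Big),$$ where $\nabla$ is the Levi-Civita connection of $g$ and $\gamma^a=\eta_{aa}\gamma_a$. Let $\Omega>0$ be a smooth function on $M$ and $\tilde g=\Omega^2g$. The spinor bundle of $(M,\tilde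 g)$, formed with the frames $\Omega^{-1}e^i_a$ and the same $s_{ij}$, is identified with that of $(M,g)$; let $\tilde D$ be its Dirac operator. For a spinor field $\psi$ put $\tilde\psi=\Omega^{-(n-1)/2}\psi$. Then: 1. $\tilde D\tilde\psi=\Omega^{-(n+1)/2}D\psi$ for every spinor field $\psi$. 2. If $D\psi=0$, then $\tilde D\tilde\psi=0$. 3. Let $\bar\phi=\phi^\dagger A$ be a Dirac conjugation, that is, $A$ is an invertible matrix such that $\bar\phi\psi$ is invariant under the spin group. Let $\sigma$ be an immersed hypersurface of $M$ (of dimension $n-1$), and let $d\sigma$, $d\tilde\sigma$ be the volume measures of the metrics that $g$, $\tilde g$ induce on it (with density $\sqrt{|\det h|}$ in charts, for the induced metric $h$). Then for all spinor fields $\phi,\psi$ $$\int_\sigma\bar{\tilde\phi}\,\tilde\psi\,d\tilde\sigma=\int_\sigma\bar\phi\,\psi\,d\sigma ,$$ and one integrand is integrable if and only if the other is. If $T$ is a unit normal field along $\sigma$ for $g$ (with $g(T,T)=\pm1$), then $\tilde T=\Omega^{-1}T$ is one for $\tilde g$ (with the same sign), and likewise, with $\gamma\cdot T=\sum_a T^a\gamma_a$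 for the components $T^a$ of $T$ in $e_1,\dots,e_n$, and $\tilde\gamma\cdot\tilde T$ formed in the same way in the frame $\Omega^{-1}e_1,\dots,\Omega^{-1}e_n$, $$\int_\sigma\bar{\tilde\phi}\,(\tilde\gamma\cdot\tilde T)\,\tilde\psi\,d\tilde\sigma=\int_\sigma\bar\phi\,(\gamma\cdot T)\,\psi\,d\sigma ,$$ again with one integrand integrable if and only if the other is. -/

import Mathlib

open scoped Manifold ContDiff Bundle Matrix

noncomputable section

/-! ### Pseudo-Riemannian metrics and the Levi-Civita connection -/

/-- A smooth pseudo-Riemannian metric (of arbitrary signature) on an `n`-dimensional manifold. -/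
structure PseudoRiemannianMetric (n : ℕ) (M : Type*) [TopologicalSpace M]
    [ChartedSpace (EuclideanSpace ℝ (Fin n)) M] [IsManifold (𝓡 n) ∞ M] where
  val (x : M) : TangentSpace (𝓡 n) x →L[ℝ] TangentSpace (𝓡 n) x →L[ℝ] ℝ
  symm (x : M) (v w : TangentSpace (𝓡 n) x) : val x v w = val x w v
  nondegenerate (x : M) (v : TangentSpace (𝓡 n) x) (hv : ∀ w, val x v w = 0) : v = 0
  contMDiff : ContMDiff (𝓡 n)
    ((𝓡 n).prod 𝓘(ℝ, EuclideanSpace ℝ (Fin n) →L[ℝ] EuclideanSpace ℝ (Fin n) →L[ℝ] ℝ)) ∞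
    (fun x ↦ Bundle.TotalSpace.mk'
      (EuclideanSpace ℝ (Fin n) →L[ℝ] EuclideanSpace ℝ (Fin n) →L[ℝ] ℝ)
      (E := fun x : M ↦ TangentSpace (𝓡 n) x →L[ℝ] TangentSpace (𝓡 n) x →L[ℝ] ℝ) x (val x))

namespace PseudoRiemannianMetric

variable {n : ℕ} {M : Type*} [TopologicalSpace M]
  [ChartedSpace (EuclideanSpace ℝ (Fin n)) M] [IsManifold (𝓡 n) ∞ M]

/-- The conformally related metric `Ω² g`. -/
def conformal (g : PseudoRiemannianMetric n M) (Ω : M → ℝ)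
    (hΩ : ContMDiff (𝓡 n) 𝓘(ℝ) ∞ Ω) (hpos : ∀ x, 0 < Ω x) : PseudoRiemannianMetric n M where
  val x := (Ω x) ^ 2 • g.val x
  symm x v w := by simp [g.symm x v w]
  nondegenerate x v hv := g.nondegenerate x v fun w ↦ by
    have := hv w
    simpa [(hpos x).ne'] using this
  contMDiff := (hΩ.pow 2).smul_section g.contMDiff

/-- The Levi-Civita connection of `g`, given by the Koszul formula: this is `g(∇_X Y, Z)` at `x`. -/
def leviCivita (g : PseudoRiemannianMetric n M) (X Y Z : Π x : M, TangentSpace (𝓡 n) x)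
    (x : M) : ℝ :=
  (mvfderiv (𝓡 n) (fun y ↦ g.val y (Y y) (Z y)) x (X x)
    + mvfderiv (𝓡 n) (fun y ↦ g.val y (Z y) (X y)) x (Y x)
    - mvfderiv (𝓡 n) (fun y ↦ g.val y (X y) (Y y)) x (Z x)
    + g.val x (VectorField.mlieBracket (𝓡 n) X Y x) (Z x)
    - g.val x (VectorField.mlieBracket (𝓡 n) Y Z x) (X x)
    + g.val x (VectorField.mlieBracket (𝓡 n) Z X x) (Y x)) / 2

end PseudoRiemannianMetric

/-! ### Clifford algebra and spin structures -/

/-- The standard quadratic form `v ↦ ∑ a, η a * v a ^ 2`, where `η a = ±1`, on `ℝⁿ`. -/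
abbrev signQuadraticForm {n : ℕ} (η : Fin n → ℤˣ) : QuadraticForm ℝ (Fin n → ℝ) :=
  QuadraticMap.weightedSumSquares ℝ (fun a ↦ ((η a : ℤ) : ℝ))

/-- A spin structure on `(M, g)`, where `g` has signature `η`, given by a spin frame cocycle:
an open cover `U i` with smooth `g`-orthonormal frames `e i`, and smooth transition functions
`s i j` with values in the spin group which satisfy the cocycle condition and cover the transition
functions of the frames, i.e. `s i j * v * (s i j)⁻¹ = v'` if `v`, `v'` are the components of the
same tangent vector in the frames `e j`, `e i`.

The spin group is the one of Mathlib: products of nonnull vectors that are even and satisfy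
`star s * s = 1`. It maps onto the identity component of the orthogonal group of `η`, so `M` is
oriented and, in indefinite signature, oriented in space and in time. -/
structure SpinStructure {n : ℕ} {M : Type*} [TopologicalSpace M]
    [ChartedSpace (EuclideanSpace ℝ (Fin n)) M] [IsManifold (𝓡 n) ∞ M]
    (g : PseudoRiemannianMetric n M) (η : Fin n → ℤˣ) (ι : Type*) where
  U : ι → Set M
  isOpen_U (i : ι) : IsOpen (U i)
  cover (x : M) : ∃ i, x ∈ U i
  e : ι → Fin n → Π x : M, TangentSpace (𝓡 n) x
  smooth_e (i : ι) (a : Fin n) : ContMDiffOn (𝓡 n) (𝓡 n).tangent ∞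
    (fun x ↦ (⟨x, e i a x⟩ : TangentBundle (𝓡 n) M)) (U i)
  orthonormal (i : ι) (x : M) (hx : x ∈ U i) (a b : Fin n) :
    g.val x (e i a x) (e i b x) = if a = b then ((η a : ℤ) : ℝ) else 0
  s : ι → ι → M → CliffordAlgebra (signQuadraticForm η)
  mem_spin (i j : ι) (x : M) (hi : x ∈ U i) (hj : x ∈ U j) :
    s i j x ∈ spinGroup (signQuadraticForm η)
  /-- Smoothness of a map into the finite-dimensional space `CliffordAlgebra _`, tested on linear
  functionals. -/
  smooth_s (i j : ι) (l : CliffordAlgebra (signQuadraticForm η) →ₗ[ℝ] ℝ) :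
    ContMDiffOn (𝓡 n) 𝓘(ℝ) ∞ (fun x ↦ l (s i j x)) (U i ∩ U j)
  cocycle (i j k : ι) (x : M) (hi : x ∈ U i) (hj : x ∈ U j) (hk : x ∈ U k) :
    s i j x * s j k x = s i k x
  frame_trans (i j : ι) (x : M) (hi : x ∈ U i) (hj : x ∈ U j) (v' v : Fin n → ℝ)
    (h : ∑ a, v' a • e i a x = ∑ a, v a • e j a x) :
    s i j x * CliffordAlgebra.ι (signQuadraticForm η) v
      = CliffordAlgebra.ι (signQuadraticForm η) v' * s i j x

namespace SpinStructure

variable {n : ℕ} {M : Type*} [TopologicalSpace M]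
  [ChartedSpace (EuclideanSpace ℝ (Fin n)) M] [IsManifold (𝓡 n) ∞ M]
  {g : PseudoRiemannianMetric n M} {η : Fin n → ℤˣ} {ι : Type*}

/-- The spin structure on `(M, Ω² g)` that corresponds to one on `(M, g)`: the frames are rescaled
by `Ω⁻¹`, with the same spin transition functions. -/
def conformal (σ : SpinStructure g η ι) (Ω : M → ℝ)
    (hΩ : ContMDiff (𝓡 n) 𝓘(ℝ) ∞ Ω) (hpos : ∀ x, 0 < Ω x) :
    SpinStructure (g.conformal Ω hΩ hpos) η ι where
  U := σ.U
  isOpen_U := σ.isOpen_U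
  cover := σ.cover
  e i a x := (Ω x)⁻¹ • σ.e i a x
  smooth_e i a := (hΩ.inv₀ fun x ↦ (hpos x).ne').contMDiffOn.smul_section (σ.smooth_e i a)
  orthonormal i x hx a b := by
    have h := σ.orthonormal i x hx a b
    have h0 := (hpos x).ne'
    simp only [PseudoRiemannianMetric.conformal, map_smul, smul_apply, h, smul_eq_mul]
    field_simp
  s := σ.s
  mem_spin := σ.mem_spin
  smooth_s := σ.smooth_s
  cocycle := σ.cocycle
  frame_trans i j x hi hj v' v h := σ.frame_trans i j x hi hj v' v <| by
    have h0 := (hpos x).ne'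
    have h1 (c : Fin n → ℝ) (k : ι) :
        ∑ a, c a • (Ω x)⁻¹ • σ.e k a x = (Ω x)⁻¹ • ∑ a, c a • σ.e k a x := by
      rw [Finset.smul_sum]
      exact Finset.sum_congr rfl fun a _ ↦ smul_comm _ _ _
    rw [h1, h1] at h
    exact smul_right_injective _ (inv_ne_zero h0) h

/-- The spin connection coefficients `ω_{abc} = g(e_b, ∇_{e_a} e_c)` in the frame `e i`. -/
def spinConnection (σ : SpinStructure g η ι) (i : ι) (a b c : Fin n) (x : M) : ℝ :=
  g.leviCivita (σ.e i a) (σ.e i c) (σ.e i b) x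

end SpinStructure

/-! ### Spinor fields and the Dirac operator

Spinors take values in `ℂᴺ` with a complex representation `ρ` of the (real) Clifford algebra.
Dirac spinors are the case in which `ρ` is irreducible. -/

/-- The gamma matrices `γ_a`, which satisfy `γ_a γ_b + γ_b γ_a = 2 η_{ab}`. -/
def gammaMatrix {n N : ℕ} {η : Fin n → ℤˣ}
    (ρ : CliffordAlgebra (signQuadraticForm η) →ₐ[ℝ] Matrix (Fin N) (Fin N) ℂ) (a : Fin n) :
    Matrix (Fin N) (Fin N) ℂ :=
  ρ (CliffordAlgebra.ι (signQuadraticForm η) (Pi.single a 1))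

/-- A smooth section of the spinor bundle which is associated to the spin structure `σ` by `ρ`,
given by its components in the spin frames. -/
structure SpinorField {n N : ℕ} {M : Type*} [TopologicalSpace M]
    [ChartedSpace (EuclideanSpace ℝ (Fin n)) M] [IsManifold (𝓡 n) ∞ M]
    {g : PseudoRiemannianMetric n M} {η : Fin n → ℤˣ} {ι : Type*} (σ : SpinStructure g η ι)
    (ρ : CliffordAlgebra (signQuadraticForm η) →ₐ[ℝ] Matrix (Fin N) (Fin N) ℂ) where
  comp : ι → M → (Fin N → ℂ)
  smooth (i : ι) : ContMDiffOn (𝓡 n) 𝓘(ℝ, Fin N → ℂ) ∞ (comp i) (σ.U i)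
  trans (i j : ι) (x : M) (hi : x ∈ σ.U i) (hj : x ∈ σ.U j) :
    comp i x = ρ (σ.s i j x) *ᵥ comp j x

namespace SpinorField

variable {n N : ℕ} {M : Type*} [TopologicalSpace M]
  [ChartedSpace (EuclideanSpace ℝ (Fin n)) M] [IsManifold (𝓡 n) ∞ M]
  {g : PseudoRiemannianMetric n M} {η : Fin n → ℤˣ} {ι : Type*} {σ : SpinStructure g η ι}
  {ρ : CliffordAlgebra (signQuadraticForm η) →ₐ[ℝ] Matrix (Fin N) (Fin N) ℂ}

/-- The spinor field `Ω ^ w • ψ` on `(M, Ω² g)`, for a spinor field `ψ` on `(M, g)`. -/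
def rescale (ψ : SpinorField σ ρ) (Ω : M → ℝ)
    (hΩ : ContMDiff (𝓡 n) 𝓘(ℝ) ∞ Ω) (hpos : ∀ x, 0 < Ω x) (w : ℝ) :
    SpinorField (σ.conformal Ω hΩ hpos) ρ where
  comp i x := (Ω x) ^ w • ψ.comp i x
  smooth i := by
    have h : ContMDiff (𝓡 n) 𝓘(ℝ) ∞ (fun x ↦ (Ω x) ^ w) := fun x ↦
      ((Real.contDiffAt_rpow_const_of_ne (hpos x).ne').contMDiffAt).comp x (hΩ x)
    exact h.contMDiffOn.smul (ψ.smooth i)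
  trans i j x hi hj := by
    rw [ψ.trans i j x hi hj, Matrix.mulVec_smul]
    rfl

/-- The spinor covariant derivative `∇_{e_a} ψ = e_a(ψ) + ¼ ∑ ω_{abc} γ^b γ^c ψ` in the frame
`e i`, where `γ^b = η_b γ_b`. -/
def covDeriv (ψ : SpinorField σ ρ) (i : ι) (a : Fin n) (x : M) : Fin N → ℂ :=
  mvfderiv (𝓡 n) (ψ.comp i) x (σ.e i a x)
    + (1 / 4 : ℝ) • ∑ b, ∑ c, (((η b : ℤ) : ℝ) * ((η c : ℤ) : ℝ) * σ.spinConnection i a b c x) •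
        ((gammaMatrix ρ b * gammaMatrix ρ c) *ᵥ ψ.comp i x)

/-- The Dirac operator `D ψ = ∑ γ^a ∇_{e_a} ψ`: its components in the frame `e i`. -/
def dirac (ψ : SpinorField σ ρ) (i : ι) (x : M) : Fin N → ℂ :=
  ∑ a, ((η a : ℤ) : ℝ) • (gammaMatrix ρ a *ᵥ ψ.covDeriv i a x)

/-- `ψ` solves the Dirac equation `D ψ = 0`. -/
def IsDiracSolution (ψ : SpinorField σ ρ) : Prop :=
  ∀ i, ∀ x ∈ σ.U i, ψ.dirac i x = 0

/-- The function `φ̄ ψ` on `M`, where `φ̄ = φ† A` is the Dirac conjugate. It is computed in any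
of the frames at `x`. -/
def pairing (A : Matrix (Fin N) (Fin N) ℂ) (φ ψ : SpinorField σ ρ) (x : M) : ℂ :=
  star (φ.comp (σ.cover x).choose x) ⬝ᵥ (A *ᵥ ψ.comp (σ.cover x).choose x)

/-- The function `φ̄ (γ · T) ψ` at `x`, for a tangent vector `T` at `x`; here
`γ · T = ∑ a, T^a γ_a` with the components `T^a = η_a g(T, e_a)` of `T`. -/
def normalPairing (A : Matrix (Fin N) (Fin N) ℂ) (φ ψ : SpinorField σ ρ) (x : M)
    (T : TangentSpace (𝓡 n) x) : ℂ :=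
  star (φ.comp (σ.cover x).choose x) ⬝ᵥ (A *ᵥ
    ((∑ a, (((η a : ℤ) : ℝ) * g.val x T (σ.e (σ.cover x).choose a x)) • gammaMatrix ρ a) *ᵥ
      ψ.comp (σ.cover x).choose x))

end SpinorField

/-- `A` defines a Dirac conjugation `φ̄ = φ† A`: it is invertible and `φ̄ ψ` is invariant under the
spin group. (The usual choices, with `γ_a† A = ± A γ_a` and one sign for all `a`, have this
property.) -/
def IsDiracConjugation {n N : ℕ} {η : Fin n → ℤˣ}
    (ρ : CliffordAlgebra (signQuadraticForm η) →ₐ[ℝ] Matrix (Fin N) (Fin N) ℂ)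
    (A : Matrix (Fin N) (Fin N) ℂ) : Prop :=
  IsUnit A ∧ ∀ s ∈ spinGroup (signQuadraticForm η), (ρ s)ᴴ * A * ρ s = A

/-- The function `φ̄ ψ` does not depend on the frame in which it is computed. -/
theorem SpinorField.pairing_eq {n N : ℕ} {M : Type*} [TopologicalSpace M]
    [ChartedSpace (EuclideanSpace ℝ (Fin n)) M] [IsManifold (𝓡 n) ∞ M]
    {g : PseudoRiemannianMetric n M} {η : Fin n → ℤˣ} {ι : Type*} {σ : SpinStructure g η ι}
    {ρ : CliffordAlgebra (signQuadraticForm η) →ₐ[ℝ] Matrix (Fin N) (Fin N) ℂ}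
    {A : Matrix (Fin N) (Fin N) ℂ} (hA : IsDiracConjugation ρ A) (φ ψ : SpinorField σ ρ)
    (i : ι) (x : M) (hi : x ∈ σ.U i) :
    φ.pairing A ψ x = star (φ.comp i x) ⬝ᵥ (A *ᵥ ψ.comp i x) := by
  have hj := (σ.cover x).choose_spec
  have h := hA.2 _ (σ.mem_spin i _ x hi hj)
  rw [φ.trans i _ x hi hj, ψ.trans i _ x hi hj, Matrix.star_mulVec, Matrix.mulVec_mulVec,
    ← Matrix.dotProduct_mulVec, Matrix.mulVec_mulVec, ← Matrix.mul_assoc, h]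
  rfl

/-- The function `φ̄ (γ · T) ψ` does not depend on the frame in which it is computed. -/
theorem SpinorField.normalPairing_eq {n N : ℕ} {M : Type*} [TopologicalSpace M]
    [ChartedSpace (EuclideanSpace ℝ (Fin n)) M] [IsManifold (𝓡 n) ∞ M]
    {g : PseudoRiemannianMetric n M} {η : Fin n → ℤˣ} {ι : Type*} {σ : SpinStructure g η ι}
    {ρ : CliffordAlgebra (signQuadraticForm η) →ₐ[ℝ] Matrix (Fin N) (Fin N) ℂ}
    {A : Matrix (Fin N) (Fin N) ℂ} (hA : IsDiracConjugation ρ A) (φ ψ : SpinorField σ ρ)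
    (i : ι) (x : M) (hi : x ∈ σ.U i) (T : TangentSpace (𝓡 n) x) :
    φ.normalPairing A ψ x T = star (φ.comp i x) ⬝ᵥ (A *ᵥ
      ((∑ a, (((η a : ℤ) : ℝ) * g.val x T (σ.e i a x)) • gammaMatrix ρ a) *ᵥ ψ.comp i x)) := by
  have key (k : ι) (hk : x ∈ σ.U k) :
      ∑ a, (((η a : ℤ) : ℝ) * g.val x T (σ.e k a x)) • σ.e k a x = T := by
    have hη (a : Fin n) : (((η a : ℤ) : ℝ)) * ((η a : ℤ) : ℝ) = 1 := by
      rcases Int.units_eq_one_or (η a) with h | h <;> simp [h]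
    have hli : LinearIndependent ℝ (fun a ↦ σ.e k a x) := by
      rw [Fintype.linearIndependent_iff]
      intro c hc b
      have h1 := congrArg (fun w ↦ g.val x w (σ.e k b x)) hc
      simp [σ.orthonormal k x hk] at h1
      exact h1
    have : FiniteDimensional ℝ (TangentSpace (𝓡 n) x) :=
      inferInstanceAs (FiniteDimensional ℝ (EuclideanSpace ℝ (Fin n)))
    have hspan := hli.span_eq_top_of_card_eq_finrank' (by
      change _ = Module.finrank ℝ (EuclideanSpace ℝ (Fin n)); simp)
    refine sub_eq_zero.1 (g.nondegenerate x _ fun w ↦ ?_)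
    have hw : w ∈ Submodule.span ℝ (Set.range fun a ↦ σ.e k a x) := hspan ▸ Submodule.mem_top
    induction hw using Submodule.span_induction with
    | mem w h =>
      obtain ⟨b, rfl⟩ := h
      simp [σ.orthonormal k x hk]
      rw [mul_right_comm, hη]; simp
    | zero => simp
    | add u v _ _ hu hv => rw [map_add, hu, hv, add_zero]
    | smul c u _ hu => rw [map_smul, hu, smul_zero]
  have hρ (c : Fin n → ℝ) : ∑ a, c a • gammaMatrix ρ a
      = ρ (CliffordAlgebra.ι (signQuadraticForm η) c) := by
    conv_rhs => rw [pi_eq_sum_univ' c]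
    simp only [map_sum, map_smul, gammaMatrix]
  have hj := (σ.cover x).choose_spec
  have h := hA.2 _ (σ.mem_spin i _ x hi hj)
  have ht := congrArg ρ (σ.frame_trans i _ x hi hj _ _ ((key i hi).trans (key _ hj).symm))
  rw [map_mul, map_mul, ← hρ, ← hρ] at ht
  rw [φ.trans i _ x hi hj, ψ.trans i _ x hi hj, Matrix.star_mulVec,
    ← Matrix.dotProduct_mulVec]
  simp only [Matrix.mulVec_mulVec]
  rw [← ht, ← Matrix.mul_assoc, ← Matrix.mul_assoc, h,
    ← Matrix.mulVec_mulVec]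
  rfl

/-! ### Hypersurfaces -/

section Hypersurface

variable {n : ℕ} (m : ℕ) {M : Type*} [TopologicalSpace M]
  [ChartedSpace (EuclideanSpace ℝ (Fin n)) M] [IsManifold (𝓡 n) ∞ M]
  {S : Type*} [TopologicalSpace S] [ChartedSpace (EuclideanSpace ℝ (Fin m)) S]

/-- The matrix of the metric induced on `S` by `f : S → M`, in the chart of `S` at `p`. -/
def inducedGram (g : PseudoRiemannianMetric n M) (f : S → M) (p : S)
    (u : EuclideanSpace ℝ (Fin m)) : Matrix (Fin m) (Fin m) ℝ :=
  Matrix.of fun k l ↦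
    g.val ((f ∘ (extChartAt (𝓡 m) p).symm) u)
      (mfderiv (𝓡 m) (𝓡 n) (f ∘ (extChartAt (𝓡 m) p).symm) u (EuclideanSpace.single k (1 : ℝ)))
      (mfderiv (𝓡 m) (𝓡 n) (f ∘ (extChartAt (𝓡 m) p).symm) u (EuclideanSpace.single l (1 : ℝ)))

/-- The volume measure `√|det h| du` of the induced metric `h`, on the domain of the chart of `S`
at `p`. -/
def chartVolume [MeasurableSpace S] (g : PseudoRiemannianMetric n M) (f : S → M) (p : S) :
    MeasureTheory.Measure S :=
  (((MeasureTheory.volume : MeasureTheory.Measure (EuclideanSpace ℝ (Fin m))).restrict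
      (extChartAt (𝓡 m) p).target).withDensity
    (fun u ↦ ENNReal.ofReal (Real.sqrt |(inducedGram m g f p u).det|))).map
      (extChartAt (𝓡 m) p).symm

/-- The volume measure `dσ` on `S` of the metric induced by `f : S → M`. The chart measures agree
on overlaps, so that their supremum is the measure on `S` that extends all of them. -/
def inducedVolume [MeasurableSpace S] (g : PseudoRiemannianMetric n M) (f : S → M) :
    MeasureTheory.Measure S :=
  ⨆ p : S, chartVolume m g f p

/-- `T` is a unit normal field along `f : S → M`, with `g(T, T) = ε`. -/
def IsUnitNormal (g : PseudoRiemannianMetric n M) (f : S → M) (ε : ℤˣ)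
    (T : Π y : S, TangentSpace (𝓡 n) (f y)) : Prop :=
  ∀ y, g.val (f y) (T y) (T y) = ((ε : ℤ) : ℝ) ∧
    ∀ v : TangentSpace (𝓡 m) y, g.val (f y) (T y) (mfderiv (𝓡 m) (𝓡 n) f y v) = 0

end Hypersurface

end

/-! Write $u=\Omega^{-1}$. In an orthonormal frame the Koszul formula only sees Lie brackets, and
$[uV,uW]=u^2[V,W]+u\,V(u)\,W-u\,W(u)\,V$. The frame $u e_a$ of $\Omega^2g$ therefore has spin
connection $u\,\omega_{abc}+\eta_a\delta_{ac}\,e_b(u)-\eta_a\delta_{ab}\,e_c(u)$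
(`spinConnection_conformal`). With $G=\sum_b\gamma^b e_b(u)$ this gives, for any weight $w$,
$\tilde\nabla_a(\Omega^w\psi)=\Omega^w\big(u\nabla_a\psi-w\,e_a(u)\psi+\tfrac14(G\gamma_a-\gamma_aG)\psi\big)$
(`covDeriv_rescale`). Contracting with $\gamma^a$ and using $\gamma^a\gamma_a=n$ and
$\gamma^a\gamma_b\gamma_a=(2-n)\gamma_b$, the terms in $du$ add up to $(-w-\tfrac{n-1}2)G\psi$. They
vanish for $w=-(n-1)/2$ (`sum_gammaMatrix_conformal`); what remains has weight $w-1=-(n+1)/2$.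

The integrals are a count of weights. The induced metric on a hypersurface of dimension $m=n-1$
scales by $\Omega^2$, so its volume scales by $\Omega^m$ (`inducedVolume_conformal`), and the two
spinors contribute $\Omega^{-(n-1)}$. The components of a unit normal in the rescaled frame are
unchanged, so inserting $\gamma\cdot T$ adds no weight. -/

/-! ### Derivatives and Lie brackets under rescaling -/

theorem mvfderiv_real_comp_apply {n : ℕ} {M : Type*} [TopologicalSpace M]
    [ChartedSpace (EuclideanSpace ℝ (Fin n)) M] {f : M → ℝ} {x : M}
    (hf : MDifferentiableAt (𝓡 n) 𝓘(ℝ) f x) {h : ℝ → ℝ} {h' : ℝ} (hh : HasDerivAt h h' (f x))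
    (v : TangentSpace (𝓡 n) x) :
    mvfderiv (𝓡 n) (fun y ↦ h (f y)) x v = h' * mvfderiv (𝓡 n) f x v := by
  have h1 := mvfderiv_comp_apply (I := 𝓘(ℝ)) (I' := 𝓡 n) (g := h) (f := f) x
    hh.differentiableAt.mdifferentiableAt hf v
  refine h1.trans ?_
  have h2 : mvfderiv 𝓘(ℝ) h (f x) = fderiv ℝ h (f x) := by
    rw [mvfderiv, mfderiv_eq_fderiv]
    rfl
  rw [h2, hh.hasFDerivAt.fderiv]
  exact (smul_eq_mul _ _).trans (mul_comm _ _)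

/-- The Leibniz rule in both slots; it is needed for $u=\Omega^{-1}$ and two vectors of a frame. -/
theorem mlieBracket_smul_smul {n : ℕ} {M : Type*} [TopologicalSpace M]
    [ChartedSpace (EuclideanSpace ℝ (Fin n)) M] [IsManifold (𝓡 n) ∞ M]
    {u : M → ℝ} {V W : Π x : M, TangentSpace (𝓡 n) x} {x : M}
    (hu : MDifferentiableAt (𝓡 n) 𝓘(ℝ) u x)
    (hV : MDifferentiableAt (𝓡 n) (𝓡 n).tangent (fun y ↦ (⟨y, V y⟩ : TangentBundle (𝓡 n) M)) x)
    (hW : MDifferentiableAt (𝓡 n) (𝓡 n).tangent (fun y ↦ (⟨y, W y⟩ : TangentBundle (𝓡 n) M)) x) :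
    VectorField.mlieBracket (𝓡 n) (fun y ↦ u y • V y) (fun y ↦ u y • W y) x
      = (u x * u x) • VectorField.mlieBracket (𝓡 n) V W x
        + (u x * mvfderiv (𝓡 n) u x (V x)) • W x - (u x * mvfderiv (𝓡 n) u x (W x)) • V x := by
  have : IsManifold (𝓡 n) (minSmoothness ℝ 2) M := by
    simp only [minSmoothness_of_isRCLikeNormedField]
    exact IsManifold.of_le (n := ∞) ENat.LEInfty.out
  have huV : MDifferentiableAt (𝓡 n) (𝓡 n).tangent
      (fun y ↦ (⟨y, (u • V) y⟩ : TangentBundle (𝓡 n) M)) x := hu.smul_section hV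
  change VectorField.mlieBracket (𝓡 n) (u • V) (u • W) x = _
  rw [VectorField.mlieBracket_smul_right hu hW, VectorField.mlieBracket_smul_left hu hV]
  simp only [Pi.smul_apply', map_smul, smul_eq_mul, smul_add, smul_smul, neg_smul, smul_neg]
  module


/-! ### The spin connection in orthonormal frames -/

namespace SpinStructure

variable {n : ℕ} {M : Type*} [TopologicalSpace M]
  [ChartedSpace (EuclideanSpace ℝ (Fin n)) M] [IsManifold (𝓡 n) ∞ M]
  {g : PseudoRiemannianMetric n M} {η : Fin n → ℤˣ} {ι : Type*}

theorem mdifferentiableAt_e (σ : SpinStructure g η ι) {i : ι} {x : M} (hx : x ∈ σ.U i)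
    (a : Fin n) :
    MDifferentiableAt (𝓡 n) (𝓡 n).tangent
      (fun y ↦ (⟨y, σ.e i a y⟩ : TangentBundle (𝓡 n) M)) x :=
  ((σ.smooth_e i a).contMDiffAt ((σ.isOpen_U i).mem_nhds hx)).mdifferentiableAt (by simp)

/-- In an orthonormal frame only the Lie brackets contribute to the Koszul formula. -/
theorem spinConnection_eq (σ : SpinStructure g η ι) {i : ι} {x : M} (hx : x ∈ σ.U i)
    (a b c : Fin n) :
    σ.spinConnection i a b c x
      = (g.val x (VectorField.mlieBracket (𝓡 n) (σ.e i a) (σ.e i c) x) (σ.e i b x)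
        - g.val x (VectorField.mlieBracket (𝓡 n) (σ.e i c) (σ.e i b) x) (σ.e i a x)
        + g.val x (VectorField.mlieBracket (𝓡 n) (σ.e i b) (σ.e i a) x) (σ.e i c x)) / 2 := by
  have h (a b : Fin n) : mvfderiv (𝓡 n) (fun y ↦ g.val y (σ.e i a y) (σ.e i b y)) x = 0 := by
    have h1 : (fun y ↦ g.val y (σ.e i a y) (σ.e i b y)) =ᶠ[nhds x]
        fun _ ↦ if a = b then ((η a : ℤ) : ℝ) else 0 := by
      filter_upwards [(σ.isOpen_U i).mem_nhds hx] with y hy using σ.orthonormal i y hy a b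
    rw [mvfderiv, h1.mfderiv_eq, mfderiv_const]
    rfl
  simp only [spinConnection, PseudoRiemannianMetric.leviCivita, h]
  simp

/-- The spin connection coefficients of `Ω² g` in the rescaled frame. -/
theorem spinConnection_conformal (σ : SpinStructure g η ι) (Ω : M → ℝ)
    (hΩ : ContMDiff (𝓡 n) 𝓘(ℝ) ∞ Ω) (hpos : ∀ x, 0 < Ω x) {i : ι} {x : M} (hx : x ∈ σ.U i)
    (a b c : Fin n) :
    (σ.conformal Ω hΩ hpos).spinConnection i a b c x
      = (Ω x)⁻¹ * σ.spinConnection i a b c x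
        + (if a = c then ((η a : ℤ) : ℝ) else 0)
          * mvfderiv (𝓡 n) (fun y ↦ (Ω y)⁻¹) x (σ.e i b x)
        - (if a = b then ((η a : ℤ) : ℝ) else 0)
          * mvfderiv (𝓡 n) (fun y ↦ (Ω y)⁻¹) x (σ.e i c x) := by
  have hu : MDifferentiableAt (𝓡 n) 𝓘(ℝ) (fun y ↦ (Ω y)⁻¹) x :=
    (hΩ.inv₀ fun x ↦ (hpos x).ne').mdifferentiableAt (by simp)
  have h0 := (hpos x).ne'
  -- The factor $\Omega^2$ of the metric and the factor $u$ of the third frame vector leave one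
  -- power $\Omega$ to multiply the bracket formula.
  have hb (a b c : Fin n) :
      (g.conformal Ω hΩ hpos).val x (VectorField.mlieBracket (𝓡 n)
          ((σ.conformal Ω hΩ hpos).e i a) ((σ.conformal Ω hΩ hpos).e i b) x)
          ((σ.conformal Ω hΩ hpos).e i c x)
        = (Ω x)⁻¹ * g.val x (VectorField.mlieBracket (𝓡 n) (σ.e i a) (σ.e i b) x) (σ.e i c x)
          + (if b = c then ((η b : ℤ) : ℝ) else 0)
            * mvfderiv (𝓡 n) (fun y ↦ (Ω y)⁻¹) x (σ.e i a x)
          - (if a = c then ((η a : ℤ) : ℝ) else 0)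
            * mvfderiv (𝓡 n) (fun y ↦ (Ω y)⁻¹) x (σ.e i b x) := by
    have h1 := mlieBracket_smul_smul hu (σ.mdifferentiableAt_e hx a) (σ.mdifferentiableAt_e hx b)
    simp only [conformal, PseudoRiemannianMetric.conformal]
    rw [h1]
    simp only [map_add, map_sub, map_smul, add_apply, sub_apply,
      smul_apply, smul_eq_mul, σ.orthonormal i x hx]
    field_simp
  rw [spinConnection_eq _ hx, spinConnection_eq (σ.conformal Ω hΩ hpos) (i := i) hx, hb, hb, hb]
  -- Each Kronecker term must appear with one order of its indices; then the two terms with $e_a(u)$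
  -- cancel and the others double.
  have hsymm (a b : Fin n) : (if a = b then ((η a : ℤ) : ℝ) else 0)
      = if b = a then ((η b : ℤ) : ℝ) else 0 := by
    rcases eq_or_ne a b with rfl | h
    · rfl
    · rw [if_neg h, if_neg h.symm]
  rw [hsymm c b, hsymm c a, hsymm b a]
  ring

end SpinStructure

/-! ### Gamma matrix identities -/

section GammaMatrix

variable {n N : ℕ} {η : Fin n → ℤˣ}
  (ρ : CliffordAlgebra (signQuadraticForm η) →ₐ[ℝ] Matrix (Fin N) (Fin N) ℂ)

theorem unit_sign_mul_self (η : Fin n → ℤˣ) (a : Fin n) : ((η a : ℤ) : ℝ) * ((η a : ℤ) : ℝ) = 1 := by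
  rcases Int.units_eq_one_or (η a) with h | h <;> simp [h]

theorem gammaMatrix_mul_self (a : Fin n) :
    gammaMatrix ρ a * gammaMatrix ρ a = ((η a : ℤ) : ℝ) • 1 := by
  rw [gammaMatrix, ← map_mul, CliffordAlgebra.ι_sq_scalar, AlgHom.commutes,
    Algebra.algebraMap_eq_smul_one]
  congr 1
  simp [QuadraticMap.weightedSumSquares_apply, Pi.single_apply]

theorem gammaMatrix_mul_add_swap {a b : Fin n} (hab : a ≠ b) :
    gammaMatrix ρ a * gammaMatrix ρ b + gammaMatrix ρ b * gammaMatrix ρ a = 0 := by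
  rw [gammaMatrix, gammaMatrix, ← map_mul ρ, ← map_mul ρ, ← map_add ρ,
    CliffordAlgebra.ι_mul_ι_add_swap, AlgHom.commutes, Algebra.algebraMap_eq_smul_one]
  have h : QuadraticMap.polar (signQuadraticForm η) (Pi.single a 1) (Pi.single b 1) = 0 := by
    simp only [QuadraticMap.polar, QuadraticMap.weightedSumSquares_apply, ← Finset.sum_sub_distrib]
    refine Finset.sum_eq_zero fun c _ ↦ ?_
    rcases eq_or_ne c a with rfl | hc
    · simp [hab]
    · simp [hc]
  rw [h, zero_smul]

theorem sum_gammaMatrix_mul_self :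
    ∑ a, ((η a : ℤ) : ℝ) • (gammaMatrix ρ a * gammaMatrix ρ a) = (n : ℝ) • 1 := by
  simp only [gammaMatrix_mul_self, smul_smul, unit_sign_mul_self, one_smul, Finset.sum_const,
    Finset.card_univ, Fintype.card_fin]
  exact (Nat.cast_smul_eq_nsmul ℝ n 1).symm

/-- `γ^a γ_b γ_a = (2 - n) γ_b`. -/
theorem sum_gammaMatrix_mul_mul (b : Fin n) :
    ∑ a, ((η a : ℤ) : ℝ) • (gammaMatrix ρ a * (gammaMatrix ρ b * gammaMatrix ρ a))
      = (2 - n : ℝ) • gammaMatrix ρ b := by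
  -- The term is $\gamma_b$ for $a=b$ and $-\gamma_b$ otherwise, since $\gamma_a$ then anticommutes
  -- past $\gamma_b$. Written as $2\delta_{ab}\gamma_b-\gamma_b$, it sums at once.
  have h (a : Fin n) : ((η a : ℤ) : ℝ) • (gammaMatrix ρ a * (gammaMatrix ρ b * gammaMatrix ρ a))
      = (if a = b then (2 : ℝ) • gammaMatrix ρ b else 0) - gammaMatrix ρ b := by
    split_ifs with hab
    · subst hab
      rw [gammaMatrix_mul_self, mul_smul_comm, smul_smul, unit_sign_mul_self, mul_one]
      module
    · rw [← eq_neg_of_add_eq_zero_left (gammaMatrix_mul_add_swap ρ hab) |> neg_eq_iff_eq_neg.2,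
        mul_neg, ← mul_assoc, gammaMatrix_mul_self, smul_mul_assoc, one_mul, smul_neg, smul_smul,
        unit_sign_mul_self]
      module
  simp only [h, Finset.sum_sub_distrib, Finset.sum_ite_eq', Finset.mem_univ, if_true,
    Finset.sum_const, Finset.card_univ, Fintype.card_fin]
  module

/-- The terms of the conformally changed Dirac operator that contain `dΩ` cancel. -/
theorem sum_gammaMatrix_conformal (u : Fin n → ℝ) :
    ∑ a, ((η a : ℤ) : ℝ) • (gammaMatrix ρ a * ((((n : ℝ) - 1) / 2 * u a) • 1
      + (1 / 4 : ℝ) • ((∑ b, (((η b : ℤ) : ℝ) * u b) • gammaMatrix ρ b) * gammaMatrix ρ a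
        - gammaMatrix ρ a * ∑ b, (((η b : ℤ) : ℝ) * u b) • gammaMatrix ρ b))) = 0 := by
  set G := ∑ b, (((η b : ℤ) : ℝ) * u b) • gammaMatrix ρ b with hG
  have h1 : ∑ a, ((η a : ℤ) : ℝ) • (gammaMatrix ρ a * (G * gammaMatrix ρ a))
      = (2 - n : ℝ) • G := by
    simp only [hG, Finset.sum_mul, Finset.mul_sum, Finset.smul_sum]
    rw [Finset.sum_comm]
    refine Finset.sum_congr rfl fun b _ ↦ ?_
    rw [smul_comm, ← sum_gammaMatrix_mul_mul, Finset.smul_sum]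
    refine Finset.sum_congr rfl fun a _ ↦ ?_
    rw [smul_mul_assoc, mul_smul_comm, smul_comm]
  have h2 : ∑ a, ((η a : ℤ) : ℝ) • (gammaMatrix ρ a * (gammaMatrix ρ a * G)) = (n : ℝ) • G := by
    have h := congrArg (· * G) (sum_gammaMatrix_mul_self ρ)
    simpa only [Finset.sum_mul, smul_mul_assoc, mul_assoc, one_mul] using h
  have h3 (a : Fin n) : ((η a : ℤ) : ℝ) • (gammaMatrix ρ a * ((((n : ℝ) - 1) / 2 * u a) • 1
      + (1 / 4 : ℝ) • (G * gammaMatrix ρ a - gammaMatrix ρ a * G)))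
      = (((n : ℝ) - 1) / 2) • ((((η a : ℤ) : ℝ) * u a) • gammaMatrix ρ a)
        + (1 / 4 : ℝ) • (((η a : ℤ) : ℝ) • (gammaMatrix ρ a * (G * gammaMatrix ρ a)))
        - (1 / 4 : ℝ) • (((η a : ℤ) : ℝ) • (gammaMatrix ρ a * (gammaMatrix ρ a * G))) := by
    simp only [mul_add, mul_sub, mul_smul_comm, mul_one]
    module
  -- The coefficients of $G$ are $\tfrac{n-1}2+\tfrac{2-n}4-\tfrac n4=0$.
  simp only [h3, Finset.sum_sub_distrib, Finset.sum_add_distrib, ← Finset.smul_sum, h1, h2, ← hG]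
  module

end GammaMatrix

/-- The weights of the volume density and of two spinors add up to zero. The form `m + 1 = n` avoids
truncated subtraction. -/
theorem pow_mul_rpow_mul_rpow {r : ℝ} (hr : 0 < r) {m n : ℕ} (hm : m + 1 = n) :
    r ^ m * (r ^ (-((n : ℝ) - 1) / 2) * r ^ (-((n : ℝ) - 1) / 2)) = 1 := by
  rw [← Real.rpow_natCast, ← Real.rpow_add hr, ← Real.rpow_add hr, ← hm]
  push_cast
  ring_nf
  exact Real.rpow_zero r

/-! ### Conformal change of the Dirac operator and of the pairings -/

namespace SpinorField

variable {n N : ℕ} {M : Type*} [TopologicalSpace M]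
  [ChartedSpace (EuclideanSpace ℝ (Fin n)) M] [IsManifold (𝓡 n) ∞ M]
  {g : PseudoRiemannianMetric n M} {η : Fin n → ℤˣ} {ι : Type*} {σ : SpinStructure g η ι}
  {ρ : CliffordAlgebra (signQuadraticForm η) →ₐ[ℝ] Matrix (Fin N) (Fin N) ℂ}

theorem covDeriv_rescale (ψ : SpinorField σ ρ) (Ω : M → ℝ) (hΩ : ContMDiff (𝓡 n) 𝓘(ℝ) ∞ Ω)
    (hpos : ∀ x, 0 < Ω x) (w : ℝ) {i : ι} {x : M} (hx : x ∈ σ.U i) (a : Fin n) :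
    (ψ.rescale Ω hΩ hpos w).covDeriv i a x = Ω x ^ w • ((Ω x)⁻¹ • ψ.covDeriv i a x
      + ((-w * mvfderiv (𝓡 n) (fun y ↦ (Ω y)⁻¹) x (σ.e i a x)) • 1
        + (1 / 4 : ℝ) • ((∑ b, (((η b : ℤ) : ℝ)
              * mvfderiv (𝓡 n) (fun y ↦ (Ω y)⁻¹) x (σ.e i b x)) • gammaMatrix ρ b)
            * gammaMatrix ρ a
          - gammaMatrix ρ a * ∑ b, (((η b : ℤ) : ℝ)
              * mvfderiv (𝓡 n) (fun y ↦ (Ω y)⁻¹) x (σ.e i b x)) • gammaMatrix ρ b))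
        *ᵥ ψ.comp i x) := by
  have h0 := (hpos x).ne'
  have hΩ' : MDifferentiableAt (𝓡 n) 𝓘(ℝ) Ω x := hΩ.mdifferentiableAt (by simp)
  -- The derivative of $\Omega^w$ is expressed by that of $\Omega^{-1}$, the one differential that
  -- also occurs in the spin connection.
  have hw (v : TangentSpace (𝓡 n) x) : (Ω x)⁻¹ * mvfderiv (𝓡 n) (fun y ↦ Ω y ^ w) x v
      = Ω x ^ w * (-w * mvfderiv (𝓡 n) (fun y ↦ (Ω y)⁻¹) x v) := by
    rw [mvfderiv_real_comp_apply hΩ' (Real.hasDerivAt_rpow_const (Or.inl h0)),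
      mvfderiv_real_comp_apply hΩ' (hasDerivAt_inv h0), Real.rpow_sub_one h0]
    field_simp
  have hd : mvfderiv (𝓡 n) ((ψ.rescale Ω hΩ hpos w).comp i) x ((Ω x)⁻¹ • σ.e i a x)
      = Ω x ^ w • ((Ω x)⁻¹ • mvfderiv (𝓡 n) (ψ.comp i) x (σ.e i a x)
        + (-w * mvfderiv (𝓡 n) (fun y ↦ (Ω y)⁻¹) x (σ.e i a x)) • ψ.comp i x) := by
    have hψ : MDifferentiableAt (𝓡 n) 𝓘(ℝ, Fin N → ℂ) (ψ.comp i) x :=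
      ((ψ.smooth i).contMDiffAt ((σ.isOpen_U i).mem_nhds hx)).mdifferentiableAt (by simp)
    have hΩw : MDifferentiableAt (𝓡 n) 𝓘(ℝ) (fun y ↦ Ω y ^ w) x :=
      (((Real.contDiffAt_rpow_const_of_ne (n := ∞) h0).contMDiffAt).comp x (hΩ x)).mdifferentiableAt
        (by simp)
    have h := mvfderiv_smul hΩw hψ
    change mvfderiv (𝓡 n) ((fun y ↦ Ω y ^ w) • ψ.comp i) x _ = _
    rw [h]
    simp only [add_apply, smul_apply, map_smul, ContinuousLinearMap.smulRight_apply, smul_add,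
      smul_smul, ← hw]
    rw [mul_comm (Ω x)⁻¹ (Ω x ^ w)]
  -- Contracted with $\gamma^b\gamma^c$, the term with $\delta_{ac}$ gives $G\gamma_a$ and the one
  -- with $\delta_{ab}$ gives $-\gamma_aG$.
  have hS : ∑ b, ∑ c, (((η b : ℤ) : ℝ) * ((η c : ℤ) : ℝ)
        * (σ.conformal Ω hΩ hpos).spinConnection i a b c x) • (gammaMatrix ρ b * gammaMatrix ρ c)
      = (Ω x)⁻¹ • (∑ b, ∑ c, (((η b : ℤ) : ℝ) * ((η c : ℤ) : ℝ) * σ.spinConnection i a b c x)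
          • (gammaMatrix ρ b * gammaMatrix ρ c))
        + ((∑ b, (((η b : ℤ) : ℝ)
              * mvfderiv (𝓡 n) (fun y ↦ (Ω y)⁻¹) x (σ.e i b x)) • gammaMatrix ρ b)
            * gammaMatrix ρ a
          - gammaMatrix ρ a * ∑ b, (((η b : ℤ) : ℝ)
              * mvfderiv (𝓡 n) (fun y ↦ (Ω y)⁻¹) x (σ.e i b x)) • gammaMatrix ρ b) := by
    -- The sign $\eta_a$ from raising the contracted index meets the $\eta_a$ of the Kronecker term.
    have hη := unit_sign_mul_self η a
    simp only [σ.spinConnection_conformal Ω hΩ hpos hx, mul_add, mul_sub, add_smul, sub_smul,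
      Finset.sum_add_distrib, Finset.sum_sub_distrib, ite_mul, zero_mul, mul_ite, mul_zero,
      ite_smul, zero_smul, Finset.sum_ite_eq, Finset.mem_univ, if_true, Finset.sum_mul,
      Finset.mul_sum, smul_mul_assoc, mul_smul_comm, Finset.smul_sum, smul_smul, add_sub_assoc]
    -- The condition `a = b` concerns the outer index; it collapses once that sum is innermost.
    rw [Finset.sum_comm (γ := Fin n) (s := Finset.univ) (t := Finset.univ) (f := fun b c ↦
      if a = b then _ else _)]
    simp only [Finset.sum_ite_eq, Finset.mem_univ, if_true]
    congr 1
    · refine Finset.sum_congr rfl fun b _ ↦ Finset.sum_congr rfl fun c _ ↦ ?_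
      congr 1
      ring
    congr 1
    · refine Finset.sum_congr rfl fun b _ ↦ ?_
      congr 1
      linear_combination ((η b : ℤ) : ℝ)
        * mvfderiv (𝓡 n) (fun y ↦ (Ω y)⁻¹) x (σ.e i b x) * hη
    · refine Finset.sum_congr rfl fun b _ ↦ ?_
      congr 1
      linear_combination ((η b : ℤ) : ℝ)
        * mvfderiv (𝓡 n) (fun y ↦ (Ω y)⁻¹) x (σ.e i b x) * hη
  have hvec (c : Fin n → Fin n → ℝ) (v : Fin N → ℂ) :
      ∑ b, ∑ c', c b c' • ((gammaMatrix ρ b * gammaMatrix ρ c') *ᵥ v)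
        = (∑ b, ∑ c', c b c' • (gammaMatrix ρ b * gammaMatrix ρ c')) *ᵥ v := by
    simp only [Matrix.sum_mulVec, Matrix.smul_mulVec]
  simp only [covDeriv, hvec, hS]
  refine (congrArg₂ (· + ·) hd rfl).trans ?_
  simp only [rescale, Matrix.mulVec_smul, Matrix.add_mulVec, Matrix.smul_mulVec,
    Matrix.one_mulVec]
  module

theorem dirac_rescale (ψ : SpinorField σ ρ) (Ω : M → ℝ) (hΩ : ContMDiff (𝓡 n) 𝓘(ℝ) ∞ Ω)
    (hpos : ∀ x, 0 < Ω x) {i : ι} {x : M} (hx : x ∈ σ.U i) :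
    (ψ.rescale Ω hΩ hpos (-((n : ℝ) - 1) / 2)).dirac i x
      = (Ω x) ^ (-((n : ℝ) + 1) / 2) • ψ.dirac i x := by
  have hexp : (Ω x) ^ (-((n : ℝ) + 1) / 2) = (Ω x) ^ (-((n : ℝ) - 1) / 2) * (Ω x)⁻¹ := by
    rw [← Real.rpow_neg_one, ← Real.rpow_add (hpos x)]
    congr 1
    ring
  have hneg : -(-((n : ℝ) - 1) / 2) = ((n : ℝ) - 1) / 2 := by ring
  have key := congrArg (· *ᵥ ψ.comp i x) (sum_gammaMatrix_conformal ρ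
    fun a ↦ mvfderiv (𝓡 n) (fun y ↦ (Ω y)⁻¹) x (σ.e i a x))
  simp only [Matrix.sum_mulVec, Matrix.zero_mulVec, Matrix.smul_mulVec,
    ← Matrix.mulVec_mulVec] at key
  simp only [dirac, covDeriv_rescale ψ Ω hΩ hpos _ hx, hneg, Matrix.mulVec_smul]
  -- The vanishing sum `key` is added to $\Omega^{-1}D\psi$, so that both sides agree term by term
  -- in $a$.
  rw [hexp, mul_smul, ← add_zero ((Ω x)⁻¹ • _), ← key, Finset.smul_sum, ← Finset.sum_add_distrib,
    Finset.smul_sum]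
  refine Finset.sum_congr rfl fun a _ ↦ ?_
  rw [Matrix.mulVec_add, Matrix.mulVec_smul]
  module

theorem IsDiracSolution.rescale {ψ : SpinorField σ ρ} (hψ : ψ.IsDiracSolution) (Ω : M → ℝ)
    (hΩ : ContMDiff (𝓡 n) 𝓘(ℝ) ∞ Ω) (hpos : ∀ x, 0 < Ω x) :
    (ψ.rescale Ω hΩ hpos (-((n : ℝ) - 1) / 2)).IsDiracSolution := fun i x hx ↦ by
  rw [dirac_rescale ψ Ω hΩ hpos hx, hψ i x hx, smul_zero]

theorem pow_smul_pairing_rescale (A : Matrix (Fin N) (Fin N) ℂ) (φ ψ : SpinorField σ ρ)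
    (Ω : M → ℝ) (hΩ : ContMDiff (𝓡 n) 𝓘(ℝ) ∞ Ω) (hpos : ∀ x, 0 < Ω x) {m : ℕ} (hm : m + 1 = n)
    (x : M) :
    Ω x ^ m • (φ.rescale Ω hΩ hpos (-((n : ℝ) - 1) / 2)).pairing A
      (ψ.rescale Ω hΩ hpos (-((n : ℝ) - 1) / 2)) x = φ.pairing A ψ x := by
  have h : Ω x ^ m * ((Ω x) ^ (-((n : ℝ) - 1) / 2) * (Ω x) ^ (-((n : ℝ) - 1) / 2)) = 1 :=
    pow_mul_rpow_mul_rpow (hpos x) hm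
  -- The rescaled spin structure has the same cover, hence the same chosen frame at `x`; no change
  -- of frame enters.
  change Ω x ^ m • (star ((Ω x) ^ (-((n : ℝ) - 1) / 2) • φ.comp (σ.cover x).choose x) ⬝ᵥ
    (A *ᵥ ((Ω x) ^ (-((n : ℝ) - 1) / 2) • ψ.comp (σ.cover x).choose x))) = _
  rw [star_smul, Matrix.mulVec_smul, dotProduct_smul, smul_dotProduct, star_trivial, smul_smul,
    smul_smul, mul_assoc, h, one_smul]
  rfl

/-- The factor $\Omega^2$ of the metric cancels the $\Omega^{-1}$ of the normal and the
$\Omega^{-1}$ of the frame, so the matrix $\gamma\cdot T$ is literally the same. -/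
theorem pow_smul_normalPairing_rescale (A : Matrix (Fin N) (Fin N) ℂ) (φ ψ : SpinorField σ ρ)
    (Ω : M → ℝ) (hΩ : ContMDiff (𝓡 n) 𝓘(ℝ) ∞ Ω) (hpos : ∀ x, 0 < Ω x) {m : ℕ} (hm : m + 1 = n)
    (x : M) (T : TangentSpace (𝓡 n) x) :
    Ω x ^ m • (φ.rescale Ω hΩ hpos (-((n : ℝ) - 1) / 2)).normalPairing A
      (ψ.rescale Ω hΩ hpos (-((n : ℝ) - 1) / 2)) x ((Ω x)⁻¹ • T) = φ.normalPairing A ψ x T := by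
  have h : Ω x ^ m * ((Ω x) ^ (-((n : ℝ) - 1) / 2) * (Ω x) ^ (-((n : ℝ) - 1) / 2)) = 1 :=
    pow_mul_rpow_mul_rpow (hpos x) hm
  have hT (a : Fin n) : (g.conformal Ω hΩ hpos).val x ((Ω x)⁻¹ • T)
      ((σ.conformal Ω hΩ hpos).e (σ.cover x).choose a x)
      = g.val x T (σ.e (σ.cover x).choose a x) := by
    have h0 := (hpos x).ne'
    simp only [PseudoRiemannianMetric.conformal, SpinStructure.conformal, map_smul, smul_apply,
      smul_eq_mul]
    field_simp
  change Ω x ^ m • (star ((Ω x) ^ (-((n : ℝ) - 1) / 2) • φ.comp (σ.cover x).choose x) ⬝ᵥ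
    (A *ᵥ ((∑ a, (((η a : ℤ) : ℝ) * (g.conformal Ω hΩ hpos).val x ((Ω x)⁻¹ • T)
      ((σ.conformal Ω hΩ hpos).e (σ.cover x).choose a x)) • gammaMatrix ρ a) *ᵥ
      ((Ω x) ^ (-((n : ℝ) - 1) / 2) • ψ.comp (σ.cover x).choose x)))) = _
  simp only [hT]
  rw [star_smul, Matrix.mulVec_smul, Matrix.mulVec_smul, dotProduct_smul, smul_dotProduct,
    star_trivial, smul_smul, smul_smul, mul_assoc, h, one_smul]
  rfl

end SpinorField

/-! ### Densities, suprema and pushforwards of measures -/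

namespace MeasureTheory.Measure

variable {α : Type*} [MeasurableSpace α]

theorem withDensity_mono_measure {μ ν : Measure α} (h : μ ≤ ν) (c : α → ENNReal) :
    μ.withDensity c ≤ ν.withDensity c := by
  refine Measure.le_iff.2 fun s hs ↦ ?_
  rw [withDensity_apply _ hs, withDensity_apply _ hs]
  exact lintegral_mono' (Measure.restrict_mono le_rfl h) le_rfl

/-- A density that is nowhere $0$ or $\infty$ acts on measures as an order isomorphism, with inverse
the density $c^{-1}$, so it commutes with suprema. Thus volumes can be compared chart by chart, with
no use of their agreement on overlaps. -/
theorem iSup_withDensity {κ : Sort*} (μ : κ → Measure α) {c : α → ENNReal} (hc : Measurable c)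
    (h0 : ∀ x, c x ≠ 0) (htop : ∀ x, c x ≠ ⊤) :
    ⨆ k, (μ k).withDensity c = (⨆ k, μ k).withDensity c := by
  refine le_antisymm (iSup_le fun k ↦ withDensity_mono_measure (le_iSup μ k) c) ?_
  have h1 : ⨆ k, μ k ≤ (⨆ k, (μ k).withDensity c).withDensity fun x ↦ (c x)⁻¹ := by
    refine iSup_le fun k ↦ ?_
    have h := withDensity_mono_measure (le_iSup (fun k ↦ (μ k).withDensity c) k) fun x ↦ (c x)⁻¹
    rwa [withDensity_inv_same hc (.of_forall h0) (.of_forall htop)] at h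
  refine (withDensity_mono_measure h1 c).trans_eq ?_
  have h := withDensity_inv_same (μ := ⨆ k, (μ k).withDensity c) (f := fun x ↦ (c x)⁻¹) hc.inv
    (.of_forall fun x ↦ ENNReal.inv_ne_zero.2 (htop x))
    (.of_forall fun x ↦ ENNReal.inv_ne_top.2 (h0 x))
  simpa only [inv_inv] using h

theorem map_withDensity_comp {β : Type*} [MeasurableSpace β] {μ : Measure α} {f : α → β}
    (hf : AEMeasurable f μ) {c : β → ENNReal} (hc : Measurable c) :
    (μ.withDensity (c ∘ f)).map f = (μ.map f).withDensity c := by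
  ext s hs
  have hf' : AEMeasurable f (μ.withDensity (c ∘ f)) :=
    hf.mono_ac (withDensity_absolutelyContinuous _ _)
  rw [map_apply_of_aemeasurable hf' hs, withDensity_apply _ hs,
    withDensity_apply₀ _ (hf.nullMeasurable hs), restrict_map_of_aemeasurable hf hs,
    lintegral_map' hc.aemeasurable (hf.mono_measure restrict_le_self)]
  rfl

end MeasureTheory.Measure

/-! ### Induced volume and integrals on hypersurfaces -/

section Hypersurface

open MeasureTheory

variable {n m : ℕ} {M : Type*} [TopologicalSpace M]
  [ChartedSpace (EuclideanSpace ℝ (Fin n)) M] [IsManifold (𝓡 n) ∞ M]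
  {S : Type*} [TopologicalSpace S] [ChartedSpace (EuclideanSpace ℝ (Fin m)) S]

/-- This supplies the measurability of $\sqrt{|\det h|}$ on the chart domain, needed to split a
product of densities. -/
theorem continuousOn_inducedGram [IsManifold (𝓡 m) ∞ S] (g : PseudoRiemannianMetric n M)
    {f : S → M} (hf : ContMDiff (𝓡 m) (𝓡 n) ∞ f) (p : S) :
    ContinuousOn (inducedGram m g f p) (extChartAt (𝓡 m) p).target := by
  set F := f ∘ (extChartAt (𝓡 m) p).symm
  have hopen : IsOpen (extChartAt (𝓡 m) p).target := isOpen_extChartAt_target p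
  have hFs : ContMDiffOn (𝓡 m) (𝓡 n) ∞ F (extChartAt (𝓡 m) p).target :=
    hf.comp_contMDiffOn (contMDiffOn_extChartAt_symm p)
  have hv (v : EuclideanSpace ℝ (Fin m)) : ContMDiffOn (𝓡 m) (𝓡 n).tangent ∞
      (fun u ↦ (⟨F u, mfderiv (𝓡 m) (𝓡 n) F u v⟩ : TangentBundle (𝓡 n) M))
      (extChartAt (𝓡 m) p).target := by
    -- The constant field `v` is a smooth section; the tangent map of `F` carries it to the smooth
    -- field $u\mapsto dF_u v$ along `F`.
    have h1 : ContMDiffOn (𝓡 m) (𝓡 m).tangent ∞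
        (fun u ↦ (⟨u, v⟩ : TangentBundle (𝓡 m) (EuclideanSpace ℝ (Fin m))))
        (extChartAt (𝓡 m) p).target := by
      refine ContMDiff.contMDiffOn fun u ↦ ?_
      refine (Bundle.contMDiffAt_section (F := EuclideanSpace ℝ (Fin m))
        (E := TangentSpace (𝓡 m) (M := EuclideanSpace ℝ (Fin m))) (s := fun _ ↦ v) u).2 ?_
      simpa using contMDiffAt_const
    have h2 := (hFs.contMDiffOn_tangentMapWithin (m := ∞) (by simp) hopen.uniqueMDiffOn).comp h1
      fun u hu ↦ hu
    refine h2.congr fun u hu ↦ ?_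
    simp only [Function.comp_apply, tangentMapWithin, mfderivWithin_of_isOpen hopen hu]
  refine continuousOn_pi.2 fun k ↦ continuousOn_pi.2 fun l ↦ ?_
  have h := (g.contMDiff.comp_contMDiffOn hFs).clm_bundle_apply₂ (F₁ := EuclideanSpace ℝ (Fin n))
    (F₂ := EuclideanSpace ℝ (Fin n)) (F₃ := ℝ) (E₃ := Bundle.Trivial M ℝ)
    (hv (EuclideanSpace.single k 1)) (hv (EuclideanSpace.single l 1))
  intro u hu
  have h3 := h u hu
  rw [Bundle.contMDiffWithinAt_totalSpace] at h3
  exact h3.2.continuousWithinAt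

theorem inducedGram_conformal (g : PseudoRiemannianMetric n M) (Ω : M → ℝ)
    (hΩ : ContMDiff (𝓡 n) 𝓘(ℝ) ∞ Ω) (hpos : ∀ x, 0 < Ω x) (f : S → M) (p : S)
    (u : EuclideanSpace ℝ (Fin m)) :
    inducedGram m (g.conformal Ω hΩ hpos) f p u
      = (Ω (f ((extChartAt (𝓡 m) p).symm u))) ^ 2 • inducedGram m g f p u := by
  ext k l
  rfl

theorem chartVolume_conformal [IsManifold (𝓡 m) ∞ S] [MeasurableSpace S] [BorelSpace S]
    (g : PseudoRiemannianMetric n M) (Ω : M → ℝ)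
    (hΩ : ContMDiff (𝓡 n) 𝓘(ℝ) ∞ Ω) (hpos : ∀ x, 0 < Ω x) {f : S → M}
    (hf : ContMDiff (𝓡 m) (𝓡 n) ∞ f) (p : S) :
    chartVolume m (g.conformal Ω hΩ hpos) f p
      = (chartVolume m g f p).withDensity fun y ↦ ENNReal.ofReal (Ω (f y) ^ m) := by
  have hopen : IsOpen (extChartAt (𝓡 m) p).target := isOpen_extChartAt_target p
  have hc : Measurable fun y ↦ ENNReal.ofReal (Ω (f y) ^ m) :=
    ((hΩ.continuous.comp hf.continuous).pow m).measurable.ennreal_ofReal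
  have hsymm : AEMeasurable (extChartAt (𝓡 m) p).symm
      ((volume : Measure (EuclideanSpace ℝ (Fin m))).restrict (extChartAt (𝓡 m) p).target) :=
    (continuousOn_extChartAt_symm p).aemeasurable hopen.measurableSet
  have hgram : AEMeasurable
      (fun u ↦ ENNReal.ofReal (Real.sqrt |(inducedGram m g f p u).det|))
      ((volume : Measure (EuclideanSpace ℝ (Fin m))).restrict (extChartAt (𝓡 m) p).target) := by
    refine ContinuousOn.aemeasurable ?_ hopen.measurableSet
    exact (ENNReal.continuous_ofReal.comp (Real.continuous_sqrt.comp
      (continuous_abs.comp continuous_id.matrix_det))).comp_continuousOn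
        (continuousOn_inducedGram g hf p)
  rw [chartVolume, chartVolume, ← Measure.map_withDensity_comp
    (hsymm.mono_ac (withDensity_absolutelyContinuous _ _)) hc,
    ← withDensity_mul₀ hgram (hc.comp_aemeasurable hsymm)]
  congr 2
  funext u
  have h0 := (hpos (f ((extChartAt (𝓡 m) p).symm u))).le
  simp only [Pi.mul_apply, Function.comp_apply, inducedGram_conformal, Matrix.det_smul,
    Fintype.card_fin]
  -- Here $\det(\Omega^2h)=\Omega^{2m}\det h$ for an $m\times m$ matrix, and
  -- $\sqrt{\Omega^{2m}}=\Omega^m$ as $\Omega>0$.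
  rw [← ENNReal.ofReal_mul (Real.sqrt_nonneg _), abs_mul, pow_right_comm, abs_pow, sq_abs,
    Real.sqrt_mul (sq_nonneg _), Real.sqrt_sq (pow_nonneg h0 m), mul_comm]

theorem inducedVolume_conformal [IsManifold (𝓡 m) ∞ S] [MeasurableSpace S] [BorelSpace S]
    (g : PseudoRiemannianMetric n M) (Ω : M → ℝ)
    (hΩ : ContMDiff (𝓡 n) 𝓘(ℝ) ∞ Ω) (hpos : ∀ x, 0 < Ω x) {f : S → M}
    (hf : ContMDiff (𝓡 m) (𝓡 n) ∞ f) :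
    inducedVolume m (g.conformal Ω hΩ hpos) f
      = (inducedVolume m g f).withDensity fun y ↦ ((Ω (f y) ^ m).toNNReal : ENNReal) := by
  simp only [inducedVolume, chartVolume_conformal g Ω hΩ hpos hf]
  refine Measure.iSup_withDensity _ ?_ (fun y ↦ ?_) fun y ↦ ENNReal.ofReal_ne_top
  · exact ((hΩ.continuous.comp hf.continuous).pow m).measurable.ennreal_ofReal
  · have := pow_pos (hpos (f y)) m
    simpa using this

/-- A density on `S` of conformal weight `-m` is integrated by the volume of `Ω² g` as the
original one by the volume of `g`. -/
theorem integral_inducedVolume_conformal [IsManifold (𝓡 m) ∞ S] [MeasurableSpace S]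
    [BorelSpace S] (g : PseudoRiemannianMetric n M) (Ω : M → ℝ)
    (hΩ : ContMDiff (𝓡 n) 𝓘(ℝ) ∞ Ω) (hpos : ∀ x, 0 < Ω x) {f : S → M}
    (hf : ContMDiff (𝓡 m) (𝓡 n) ∞ f) {q q' : S → ℂ} (hq : ∀ y, Ω (f y) ^ m • q' y = q y) :
    (Integrable q' (inducedVolume m (g.conformal Ω hΩ hpos) f)
      ↔ Integrable q (inducedVolume m g f)) ∧
    ∫ y, q' y ∂(inducedVolume m (g.conformal Ω hΩ hpos) f) = ∫ y, q y ∂(inducedVolume m g f) := by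
  have hc : Measurable fun y ↦ (Ω (f y) ^ m).toNNReal :=
    ((hΩ.continuous.comp hf.continuous).pow m).measurable.real_toNNReal
  have h (y : S) : (Ω (f y) ^ m).toNNReal • q' y = q y := by
    rw [← hq y, NNReal.smul_def, Real.coe_toNNReal _ (pow_pos (hpos _) m).le]
  -- Both rules ask for measurability of the density only, so `q` and `q'` may be arbitrary
  -- functions.
  rw [inducedVolume_conformal g Ω hΩ hpos hf, integrable_withDensity_iff_integrable_smul hc,
    integral_withDensity_eq_integral_smul hc]
  simp only [h, and_self, iff_self]

theorem IsUnitNormal.conformal {g : PseudoRiemannianMetric n M} (Ω : M → ℝ)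
    (hΩ : ContMDiff (𝓡 n) 𝓘(ℝ) ∞ Ω) (hpos : ∀ x, 0 < Ω x) {f : S → M} {ε : ℤˣ}
    {T : Π y : S, TangentSpace (𝓡 n) (f y)} (hT : IsUnitNormal m g f ε T) :
    IsUnitNormal m (g.conformal Ω hΩ hpos) f ε (fun y ↦ (Ω (f y))⁻¹ • T y) := by
  intro y
  have h0 := (hpos (f y)).ne'
  refine ⟨?_, fun v ↦ ?_⟩
  · simp only [PseudoRiemannianMetric.conformal, map_smul, smul_apply, (hT y).1,
      smul_eq_mul]
    field_simp
  · simp [PseudoRiemannianMetric.conformal, (hT y).2 v]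

end Hypersurface

theorem mainTheorem8 {n N : ℕ} {M : Type*} [TopologicalSpace M]
    [ChartedSpace (EuclideanSpace ℝ (Fin n)) M] [IsManifold (𝓡 n) ∞ M]
    (g : PseudoRiemannianMetric n M) {η : Fin n → ℤˣ} {ι : Type*} (σ : SpinStructure g η ι)
    (ρ : CliffordAlgebra (signQuadraticForm η) →ₐ[ℝ] Matrix (Fin N) (Fin N) ℂ)
    (Ω : M → ℝ) (hΩ : ContMDiff (𝓡 n) 𝓘(ℝ) ∞ Ω) (hpos : ∀ x, 0 < Ω x) :
    -- conformal covariance of the Dirac operator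
    (∀ ψ : SpinorField σ ρ, ∀ i, ∀ x ∈ σ.U i,
      (ψ.rescale Ω hΩ hpos (-((n : ℝ) - 1) / 2)).dirac i x
        = (Ω x) ^ (-((n : ℝ) + 1) / 2) • ψ.dirac i x) ∧
    -- solutions of the Dirac equation rescale to solutions
    (∀ ψ : SpinorField σ ρ, ψ.IsDiracSolution →
      (ψ.rescale Ω hΩ hpos (-((n : ℝ) - 1) / 2)).IsDiracSolution) ∧
    -- the inner products on a hypersurface `f : S → M` are preserved
    (∀ A : Matrix (Fin N) (Fin N) ℂ, IsDiracConjugation ρ A →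
      ∀ m : ℕ, m + 1 = n → ∀ (S : Type*) [TopologicalSpace S] [T2Space S]
        [SecondCountableTopology S] [ChartedSpace (EuclideanSpace ℝ (Fin m)) S]
        [IsManifold (𝓡 m) ∞ S] [MeasurableSpace S] [BorelSpace S] (f : S → M),
        ContMDiff (𝓡 m) (𝓡 n) ∞ f →
        (∀ y, Function.Injective (mfderiv (𝓡 m) (𝓡 n) f y)) →
        ∀ φ ψ : SpinorField σ ρ,
        -- the pairing `∫ φ̄ ψ dσ`
        ((MeasureTheory.Integrable
            (fun y ↦ (φ.rescale Ω hΩ hpos (-((n : ℝ) - 1) / 2)).pairing A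
              (ψ.rescale Ω hΩ hpos (-((n : ℝ) - 1) / 2)) (f y))
            (inducedVolume m (g.conformal Ω hΩ hpos) f) ↔
          MeasureTheory.Integrable (fun y ↦ φ.pairing A ψ (f y))
            (inducedVolume m g f)) ∧
        ∫ y, (φ.rescale Ω hΩ hpos (-((n : ℝ) - 1) / 2)).pairing A
              (ψ.rescale Ω hΩ hpos (-((n : ℝ) - 1) / 2)) (f y)
            ∂(inducedVolume m (g.conformal Ω hΩ hpos) f)
          = ∫ y, φ.pairing A ψ (f y) ∂(inducedVolume m g f)) ∧
        -- the pairing `∫ φ̄ (γ · T) ψ dσ`, for a unit normal field `T`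
        (∀ (ε : ℤˣ) (T : Π y : S, TangentSpace (𝓡 n) (f y)), IsUnitNormal m g f ε T →
          IsUnitNormal m (g.conformal Ω hΩ hpos) f ε (fun y ↦ (Ω (f y))⁻¹ • T y) ∧
          (MeasureTheory.Integrable
            (fun y ↦ (φ.rescale Ω hΩ hpos (-((n : ℝ) - 1) / 2)).normalPairing A
              (ψ.rescale Ω hΩ hpos (-((n : ℝ) - 1) / 2)) (f y) ((Ω (f y))⁻¹ • T y))
            (inducedVolume m (g.conformal Ω hΩ hpos) f) ↔
          MeasureTheory.Integrable (fun y ↦ φ.normalPairing A ψ (f y) (T y))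
            (inducedVolume m g f)) ∧
          ∫ y, (φ.rescale Ω hΩ hpos (-((n : ℝ) - 1) / 2)).normalPairing A
              (ψ.rescale Ω hΩ hpos (-((n : ℝ) - 1) / 2)) (f y) ((Ω (f y))⁻¹ • T y)
              ∂(inducedVolume m (g.conformal Ω hΩ hpos) f)
            = ∫ y, φ.normalPairing A ψ (f y) (T y) ∂(inducedVolume m g f))) := by
  refine ⟨fun ψ i x hx ↦ ψ.dirac_rescale Ω hΩ hpos hx, fun ψ hψ ↦ hψ.rescale Ω hΩ hpos, ?_⟩
  intro A _ m hm S _ _ _ _ _ _ _ f hf _ φ ψ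
  refine ⟨integral_inducedVolume_conformal g Ω hΩ hpos hf fun y ↦
    SpinorField.pow_smul_pairing_rescale A φ ψ Ω hΩ hpos hm (f y), fun ε T hT ↦
    ⟨hT.conformal Ω hΩ hpos, integral_inducedVolume_conformal g Ω hΩ hpos hf fun y ↦
      SpinorField.pow_smul_normalPairing_rescale A φ ψ Ω hΩ hpos hm (f y) (T y)⟩⟩
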